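/- Let $X$ be a proper CAT(0) space and let $G$ be a group acting geometrically on $X$, i.e. by isometries, properly (for every compact $C\subseteq X$ the set $\{g\in G : gC\cap C\neq\emptyset\}$ is finite) and co-compactly ($X/G$ is compact). Call a subgroup $H$ of $G$ convex if there is a nonempty closed convex $H$-invariant subset $Y\subseteq X$ on which $H$ acts geometrically. Let $H$ be a subgroup of $G$ and let $K\le H$ be a subgroup of finite index in $H$. If $K$ is convex, then $H$ is convex. -/

import Mathlib

/-- `γ`, restricted to `[0, dist x y]`, is a geodesic from `x` to `y`, that is, an isometric
embedding of that interval with `γ 0 = x` and `γ (dist x y) = y`. -/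
structure IsGeodesicFromTo {X : Type*} [MetricSpace X] (γ : ℝ → X) (x y : X) : Prop where
  map_zero : γ 0 = x
  map_dist : γ (dist x y) = y
  dist_eq : ∀ s ∈ Set.Icc 0 (dist x y), ∀ t ∈ Set.Icc 0 (dist x y), dist (γ s) (γ t) = |s - t|

/-- `S` is (the image of) a geodesic segment with endpoints `x` and `y`. -/
def IsGeodesicSegment {X : Type*} [MetricSpace X] (S : Set X) (x y : X) : Prop :=
  ∃ γ : ℝ → X, IsGeodesicFromTo γ x y ∧ S = γ '' Set.Icc 0 (dist x y)

/-- CAT(0) spaces: geodesic metric spaces all of whose geodesic triangles are at least as thin as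
their Euclidean comparison triangles. Two points of a geodesic triangle lie on two sides with a
common vertex, which is called `a` below, so that `y ∈ [a, b]` and `z ∈ [a, c]`; their comparison
points are the points `y' ∈ [a', b']` and `z' ∈ [a', c']` at the same distances from `a'`. -/
structure IsCATZero (X : Type*) [MetricSpace X] : Prop where
  exists_geodesic : ∀ x y : X, ∃ S : Set X, IsGeodesicSegment S x y
  comparison : ∀ (a b c : X) (ab bc ac : Set X),
    IsGeodesicSegment ab a b → IsGeodesicSegment bc b c → IsGeodesicSegment ac a c →
    ∀ a' b' c' : EuclideanSpace ℝ (Fin 2),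
      dist a' b' = dist a b → dist b' c' = dist b c → dist a' c' = dist a c →
    ∀ y ∈ ab, ∀ z ∈ ac, ∀ y' ∈ segment ℝ a' b', ∀ z' ∈ segment ℝ a' c',
      dist a' y' = dist a y → dist a' z' = dist a z → dist y z ≤ dist y' z'

/-- `C` contains every geodesic segment between two of its points. -/
def IsGeodesicallyConvex {X : Type*} [MetricSpace X] (C : Set X) : Prop :=
  ∀ x ∈ C, ∀ y ∈ C, ∀ S : Set X, IsGeodesicSegment S x y → S ⊆ C

open scoped Pointwise in
/-- A geometric action on a metric space: by isometries, proper (only finitely many group elements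
move a given compact set so that it meets itself) and co-compact. -/
structure IsGeometricAction (G X : Type*) [Group G] [MetricSpace X] [MulAction G X] : Prop where
  isometric : IsIsometricSMul G X
  proper : ∀ C : Set X, IsCompact C → {g : G | ((g • C) ∩ C).Nonempty}.Finite
  cocompact : CompactSpace (Quotient (MulAction.orbitRel G X))

/-- The subgroup `H` of `G` is convex, with respect to the given action of `G` on `X`: there is a
nonempty closed convex subset of `X` that is `H`-invariant and on which `H` acts geometrically. -/
def IsConvexSubgroup {G : Type*} (X : Type*) [Group G] [MetricSpace X] [MulAction G X]
    (H : Subgroup G) : Prop :=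
  ∃ Y : SubMulAction H X, (Y : Set X).Nonempty ∧ IsClosed (Y : Set X) ∧
    IsGeodesicallyConvex (Y : Set X) ∧ IsGeometricAction H Y

open Metric

/-! Let `K` act geometrically on `Y` and fix `y₀ ∈ Y`. The distance from `h • y₀` to `Y` depends
only on the coset of `h` modulo `K`, so finite index bounds it by some `R`. Let `Z` be the
intersection of the `H`-translates of the closed `R`-neighbourhood of `Y`. It is closed,
`H`-invariant and contains `y₀`; it is convex because the CAT(0) metric is convex. Each point of `Z`
is within `R` of `Y`, so co-compactness of `K` on `Y` already gives that of `H` on `Z`. -/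

/-- Three numbers satisfying the triangle inequalities are the side lengths of a triangle in the
Euclidean plane. -/
theorem exists_comparison_triangle {d e f : ℝ} (hd : 0 ≤ d) (he : 0 ≤ e) (hf : 0 ≤ f)
    (h₁ : d ≤ e + f) (h₂ : e ≤ d + f) (h₃ : f ≤ d + e) :
    ∃ a b c : EuclideanSpace ℝ (Fin 2), dist a b = d ∧ dist b c = f ∧ dist a c = e := by
  rcases hd.eq_or_lt with rfl | hd'
  · refine ⟨!₂[0, 0], !₂[0, 0], !₂[e, 0], ?_, ?_, ?_⟩ <;>
      simp [EuclideanSpace.dist_eq, Real.dist_eq, Real.sqrt_sq_eq_abs, abs_of_nonneg he]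
    linarith
  -- Law of cosines: with `a` at the origin and `b` at `(d, 0)`, `p` is the abscissa of `c`.
  · obtain ⟨p, hp⟩ : ∃ p : ℝ, 2 * d * p = d ^ 2 + e ^ 2 - f ^ 2 :=
      ⟨(d ^ 2 + e ^ 2 - f ^ 2) / (2 * d), by field_simp⟩
    have hpe : p ^ 2 ≤ e ^ 2 := by
      apply sq_le_sq'
      · have : 0 ≤ 2 * d * (e + p) := by nlinarith
        nlinarith [nonneg_of_mul_nonneg_right this (by positivity)]
      · have : 0 ≤ 2 * d * (e - p) := by
          nlinarith [mul_nonneg (by linarith : 0 ≤ f + d - e) (by linarith : 0 ≤ f - d + e)]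
        nlinarith [nonneg_of_mul_nonneg_right this (by positivity)]
    have hq : √(e ^ 2 - p ^ 2) ^ 2 = e ^ 2 - p ^ 2 := Real.sq_sqrt (by linarith)
    refine ⟨!₂[0, 0], !₂[d, 0], !₂[p, √(e ^ 2 - p ^ 2)], ?_, ?_, ?_⟩
    · simp [EuclideanSpace.dist_eq, Real.dist_eq, Real.sqrt_sq_eq_abs, abs_of_nonneg hd]
    · rw [EuclideanSpace.dist_eq, Real.sqrt_eq_iff_mul_self_eq (by positivity) hf]
      simp [Real.dist_eq, sq_abs, hq]
      linarith
    · rw [EuclideanSpace.dist_eq, Real.sqrt_eq_iff_mul_self_eq (by positivity) he]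
      simp [Real.dist_eq, sq_abs, hq]
      ring

section Geodesic

variable {X : Type*} [MetricSpace X]

theorem IsGeodesicFromTo.dist_left {γ : ℝ → X} {x y : X} (h : IsGeodesicFromTo γ x y) {t : ℝ}
    (ht : t ∈ Set.Icc (0 : ℝ) 1) : dist x (γ (t * dist x y)) = t * dist x y := by
  have hd := dist_nonneg (x := x) (y := y)
  have := h.dist_eq 0 ⟨le_rfl, hd⟩ (t * dist x y)
    ⟨mul_nonneg ht.1 hd, mul_le_of_le_one_left hd ht.2⟩
  rwa [h.map_zero, zero_sub, abs_neg, abs_of_nonneg (mul_nonneg ht.1 hd)] at this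

theorem IsGeodesicFromTo.mem_image {γ : ℝ → X} (x y : X) {t : ℝ}
    (ht : t ∈ Set.Icc (0 : ℝ) 1) : γ (t * dist x y) ∈ γ '' Set.Icc 0 (dist x y) :=
  Set.mem_image_of_mem _
    ⟨mul_nonneg ht.1 dist_nonneg, mul_le_of_le_one_left dist_nonneg ht.2⟩

theorem IsGeodesicFromTo.reverse {γ : ℝ → X} {x y : X} (h : IsGeodesicFromTo γ x y) :
    IsGeodesicFromTo (fun s ↦ γ (dist x y - s)) y x where
  map_zero := by simpa using h.map_dist
  map_dist := by simpa [dist_comm y x] using h.map_zero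
  dist_eq s hs t ht := by
    rw [dist_comm y x] at hs ht
    rw [h.dist_eq _ ⟨by linarith [hs.2], by linarith [hs.1]⟩ _
      ⟨by linarith [ht.2], by linarith [ht.1]⟩, ← abs_neg]
    congr 1
    ring

/-- In a CAT(0) space two geodesics issuing from the same point diverge at least as fast as
linearly. -/
theorem IsCATZero.dist_le_mul (hX : IsCATZero X) {a b c : X} {γ δ : ℝ → X}
    (hγ : IsGeodesicFromTo γ a b) (hδ : IsGeodesicFromTo δ a c) {t : ℝ}
    (ht : t ∈ Set.Icc (0 : ℝ) 1) :
    dist (γ (t * dist a b)) (δ (t * dist a c)) ≤ t * dist b c := by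
  obtain ⟨bc, hbc⟩ := hX.exists_geodesic b c
  obtain ⟨a', b', c', hab, hbc', hac⟩ := exists_comparison_triangle
    (dist_nonneg (x := a) (y := b)) (dist_nonneg (x := a) (y := c)) (dist_nonneg (x := b) (y := c))
    (by rw [dist_comm b c]; exact dist_triangle a c b) (dist_triangle a b c)
    (by rw [dist_comm a b]; exact dist_triangle b a c)
  have key := hX.comparison a b c _ bc _ ⟨γ, hγ, rfl⟩ hbc ⟨δ, hδ, rfl⟩ a' b' c' hab hbc' hac
    _ (IsGeodesicFromTo.mem_image a b ht) _ (IsGeodesicFromTo.mem_image a c ht)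
    (AffineMap.lineMap a' b' t) (by rw [segment_eq_image_lineMap]; exact ⟨t, ht, rfl⟩)
    (AffineMap.lineMap a' c' t) (by rw [segment_eq_image_lineMap]; exact ⟨t, ht, rfl⟩)
    (by rw [hγ.dist_left ht, dist_left_lineMap, hab, Real.norm_of_nonneg ht.1])
    (by rw [hδ.dist_left ht, dist_left_lineMap, hac, Real.norm_of_nonneg ht.1])
  refine key.trans_eq ?_
  rw [AffineMap.lineMap_apply_module', AffineMap.lineMap_apply_module', dist_add_right, dist_smul₀,
    dist_sub_right, hbc', Real.norm_of_nonneg ht.1]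

/-- The metric of a CAT(0) space is convex. -/
theorem IsCATZero.dist_le_convex_combination (hX : IsCATZero X) {x x' y y' : X} {γ δ : ℝ → X}
    (hγ : IsGeodesicFromTo γ x x') (hδ : IsGeodesicFromTo δ y y') {t : ℝ}
    (ht : t ∈ Set.Icc (0 : ℝ) 1) :
    dist (γ (t * dist x x')) (δ (t * dist y y')) ≤ (1 - t) * dist x y + t * dist x' y' := by
  -- The diagonal `ε` splits the quadrilateral into triangles with apexes `x` and `y'`; at `y'` the
  -- geodesics run backwards, with parameter `1 - t`.
  obtain ⟨_, ε, hε, -⟩ := hX.exists_geodesic x y'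
  have h₁ := hX.dist_le_mul hγ hε ht
  have h₂ := hX.dist_le_mul hε.reverse hδ.reverse (t := 1 - t)
    ⟨by linarith [ht.2], by linarith [ht.1]⟩
  have e₁ : dist x y' - (1 - t) * dist y' x = t * dist x y' := by rw [dist_comm y' x]; ring
  have e₂ : dist y y' - (1 - t) * dist y' y = t * dist y y' := by rw [dist_comm y' y]; ring
  simp only [e₁, e₂] at h₂
  linarith [dist_triangle (γ (t * dist x x')) (ε (t * dist x y')) (δ (t * dist y y'))]

/-- Closed neighbourhoods of closed convex subsets of a proper CAT(0) space are convex. -/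
theorem IsGeodesicallyConvex.setOf_infDist_le [ProperSpace X] (hX : IsCATZero X) {Y : Set X}
    (hY : IsGeodesicallyConvex Y) (hne : Y.Nonempty) (hcl : IsClosed Y) (R : ℝ) :
    IsGeodesicallyConvex {x | infDist x Y ≤ R} := by
  rintro x hx x' hx' _ ⟨γ, hγ, rfl⟩ _ ⟨s, hs, rfl⟩
  obtain ⟨y, hyY, hy⟩ := hcl.exists_infDist_eq_dist hne x
  obtain ⟨y', hyY', hy'⟩ := hcl.exists_infDist_eq_dist hne x'
  obtain ⟨_, δ, hδ, -⟩ := hX.exists_geodesic y y'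
  obtain ⟨t, ht, rfl⟩ : ∃ t ∈ Set.Icc (0 : ℝ) 1, t * dist x x' = s := by
    rcases (dist_nonneg (x := x) (y := x')).eq_or_lt with h | h
    · rw [← h] at hs
      exact ⟨0, by simp, by rw [zero_mul]; exact le_antisymm hs.1 hs.2⟩
    · exact ⟨s / dist x x', ⟨div_nonneg hs.1 h.le, div_le_one_of_le₀ hs.2 h.le⟩,
        div_mul_cancel₀ _ h.ne'⟩
  have hmem := hY y hyY y' hyY' _ ⟨δ, hδ, rfl⟩ (IsGeodesicFromTo.mem_image y y' ht)
  refine (infDist_le_dist_of_mem hmem).trans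
    ((hX.dist_le_convex_combination hγ hδ ht).trans ?_)
  simp only [Set.mem_ofPred_eq] at hx hx'
  rw [← hy, ← hy']
  nlinarith [ht.1, ht.2, mul_le_mul_of_nonneg_left hx (sub_nonneg.2 ht.2),
    mul_le_mul_of_nonneg_left hx' ht.1]

theorem IsGeodesicSegment.smul {G : Type*} [Group G] [MulAction G X] [IsIsometricSMul G X]
    {S : Set X} {x y : X} (h : IsGeodesicSegment S x y) (g : G) :
    IsGeodesicSegment ((fun z ↦ g • z) '' S) (g • x) (g • y) := by
  obtain ⟨γ, hγ, rfl⟩ := h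
  refine ⟨fun s ↦ g • γ s, ⟨by rw [hγ.map_zero], by rw [dist_smul, hγ.map_dist], ?_⟩, ?_⟩
  · simpa only [dist_smul] using hγ.dist_eq
  · rw [dist_smul, Set.image_image]

end Geodesic

section Action

variable {G X : Type*} [Group G] [MetricSpace X] [MulAction G X]

theorem Subgroup.isIsometricSMul [IsIsometricSMul G X] (H : Subgroup G) : IsIsometricSMul H X :=
  ⟨fun h ↦ isometry_smul X (h : G)⟩

/-- A co-compact isometric action has a ball whose translates cover the space. -/
theorem exists_forall_dist_smul_lt [IsIsometricSMul G X]
    [CompactSpace (Quotient (MulAction.orbitRel G X))] (x₀ : X) :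
    ∃ n : ℕ, ∀ x : X, ∃ g : G, dist (g • x) x₀ < n := by
  let π : X → Quotient (MulAction.orbitRel G X) := Quotient.mk _
  have hopen : IsOpenMap π := isOpenMap_quotient_mk'_mul
  obtain ⟨n, hn⟩ := isCompact_univ.elim_directed_cover (fun n : ℕ ↦ π '' ball x₀ n)
    (fun n ↦ hopen _ isOpen_ball)
    (fun q _ ↦ by
      obtain ⟨x, rfl⟩ := Quotient.exists_rep q
      obtain ⟨n, hn⟩ := exists_nat_gt (dist x x₀)
      exact Set.mem_iUnion.2 ⟨n, x, hn, rfl⟩)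
    (Monotone.directed_le fun m n hmn ↦ Set.image_mono (ball_subset_ball (by exact_mod_cast hmn)))
  refine ⟨n, fun x ↦ ?_⟩
  obtain ⟨y, hy, hyx⟩ := hn (Set.mem_univ (π x))
  obtain ⟨g, rfl⟩ := MulAction.orbitRel_apply.1 (Quotient.exact hyx)
  exact ⟨g, hy⟩

/-- An action on a proper space is co-compact if the translates of some ball cover the space. -/
theorem compactSpace_orbitRel_quotient [ProperSpace X] (x₀ : X) (r : ℝ)
    (h : ∀ x : X, ∃ g : G, dist (g • x) x₀ ≤ r) :
    CompactSpace (Quotient (MulAction.orbitRel G X)) := by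
  refine ⟨?_⟩
  convert (isCompact_closedBall x₀ r).image
    (continuous_quotient_mk' (s := MulAction.orbitRel G X))
  symm
  rw [Set.eq_univ_iff_forall]
  intro q
  obtain ⟨x, rfl⟩ := Quotient.exists_rep q
  obtain ⟨g, hg⟩ := h x
  exact ⟨g • x, hg, Quotient.sound (MulAction.orbitRel_apply.2 ⟨g, rfl⟩)⟩

open scoped Pointwise in
-- Properness is inherited, as a compact subset of `Z` is compact in `X`; only co-compactness has to
-- be supplied.
theorem IsGeometricAction.subMulAction (hG : IsGeometricAction G X) (H : Subgroup G)
    (Z : SubMulAction H X) (hZ : CompactSpace (Quotient (MulAction.orbitRel H Z))) :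
    IsGeometricAction H Z where
  isometric := ⟨fun h ↦ fun x y ↦ hG.isometric.isometry_smul (h : G) (x : X) (y : X)⟩
  proper C hC := by
    refine ((hG.proper _ (hC.image continuous_subtype_val)).preimage
      Subtype.val_injective.injOn).subset ?_
    rintro h ⟨_, ⟨z, hz, rfl⟩, hz'⟩
    exact ⟨(h : G) • (z : X), ⟨z, ⟨z, hz, rfl⟩, rfl⟩, ⟨_, hz', rfl⟩⟩
  cocompact := hZ

/-- A function on a group that is invariant under left multiplication by a subgroup of finite index
is bounded. -/
theorem Subgroup.FiniteIndex.exists_forall_le {K : Subgroup G} (hK : K.FiniteIndex) (f : G → ℝ)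
    (hf : ∀ k ∈ K, ∀ g, f (k * g) = f g) : ∃ R, ∀ g, f g ≤ R := by
  -- `G ⧸ K` consists of the cosets `gK`, whereas `f` is constant on the cosets `Kg`; inversion
  -- exchanges the two.
  obtain ⟨R, hR⟩ := (Set.finite_range fun q : G ⧸ K ↦ f q.out⁻¹).bddAbove
  refine ⟨R, fun g ↦ ?_⟩
  obtain ⟨k, hk⟩ := QuotientGroup.mk_out_eq_mul K g⁻¹
  have := hR ⟨(g⁻¹ : G), rfl⟩
  simp only [hk, mul_inv_rev, inv_inv] at this
  rwa [hf _ (inv_mem k.2)] at this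

theorem infDist_smul_of_smul_mem [IsIsometricSMul G X] {K : Subgroup G} (Y : SubMulAction K X)
    (k : K) (x : X) : infDist (k • x) (Y : Set X) = infDist x Y := by
  have := K.isIsometricSMul (X := X)
  have h : (fun y : X ↦ k • y) '' (Y : Set X) = Y := by
    ext y
    refine ⟨?_, fun hy ↦ ⟨k⁻¹ • y, Y.smul_mem _ hy, smul_inv_smul k y⟩⟩
    rintro ⟨z, hz, rfl⟩
    exact Y.smul_mem k hz
  conv_lhs => rw [← h]
  exact infDist_image (isometry_smul X k)

end Action


theorem mainTheorem11 {G X : Type*} [Group G] [MetricSpace X] [ProperSpace X] [MulAction G X]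
    (hX : IsCATZero X) (hG : IsGeometricAction G X) (H K : Subgroup G) (hKH : K ≤ H)
    (hfin : (K.subgroupOf H).FiniteIndex) (hK : IsConvexSubgroup X K) :
    IsConvexSubgroup X H := by
  obtain ⟨Y, ⟨y₀, hy₀⟩, hcl, hconv, hKY⟩ := hK
  have hne : (Y : Set X).Nonempty := ⟨y₀, hy₀⟩
  have := hG.isometric
  have := H.isIsometricSMul (X := X)
  have := hKY.isometric
  have := hKY.cocompact
  obtain ⟨n, hn⟩ := exists_forall_dist_smul_lt (G := K) (⟨y₀, hy₀⟩ : Y)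
  obtain ⟨R, hR⟩ := hfin.exists_forall_le (fun h : H ↦ infDist (h • y₀) (Y : Set X)) <| by
    intro k hk h
    rw [mul_smul]
    exact infDist_smul_of_smul_mem Y ⟨k, Subgroup.mem_subgroupOf.1 hk⟩ (h • y₀)
  let Z : SubMulAction H X :=
    { carrier := {x | ∀ h : H, infDist (h • x) (Y : Set X) ≤ R}
      smul_mem' := fun g x hx h ↦ by rw [← mul_smul]; exact hx (h * g) }
  have hZcl : IsClosed (Z : Set X) := by
    have : (Z : Set X) = ⋂ h : H, {x | infDist (h • x) (Y : Set X) ≤ R} := by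
      ext x
      exact (Set.mem_iInter (s := fun h : H ↦ {x | infDist (h • x) (Y : Set X) ≤ R})).symm
    rw [this]
    exact isClosed_iInter fun h ↦ isClosed_le
      ((continuous_infDist_pt _).comp (continuous_const_smul h)) continuous_const
  have : ProperSpace Z := .of_isClosed hZcl
  refine ⟨Z, ⟨y₀, hR⟩, hZcl, ?_, hG.subMulAction H Z ?_⟩
  · intro x hx y hy S hS z hz h
    -- Convexity is checked one translate at a time: `h` carries the segment to one with endpoints
    -- in the `R`-neighbourhood of `Y`.
    exact hconv.setOf_infDist_le hX hne hcl R _ (hx h) _ (hy h) _ (hS.smul h) ⟨z, hz, rfl⟩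
  · refine compactSpace_orbitRel_quotient (⟨y₀, hR⟩ : Z) (R + n) fun z ↦ ?_
    obtain ⟨y, hyY, hy⟩ := hcl.exists_infDist_eq_dist hne (z : X)
    obtain ⟨k, hk⟩ := hn ⟨y, hyY⟩
    -- The `k` that brings the nearest point `y` close to `y₀` also brings `z` there, up to `R`.
    refine ⟨⟨k, hKH k.2⟩, ?_⟩
    have h₁ : dist ((k : G) • (z : X)) ((k : G) • y) ≤ R := by
      rw [dist_smul, ← hy]
      simpa using z.2 1
    have h₂ : dist ((k : G) • y) y₀ < n := hk
    exact (dist_triangle _ ((k : G) • y) _).trans (add_le_add h₁ h₂.le)
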